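/- Let $(\Omega,\mathcal A,P)$ be a probability space and let $\mathbf X=(X_1,\dots,X_p)$ be a random vector on it. For a real random variable $Y$ with $\mathrm{Var}(Y)>0$ and a random vector $\mathbf Z$ put $$\xi(Y|\mathbf Z)=\frac{\int_{\mathbb R}\mathrm{Var}\big(P(Y\ge y\mid \mathbf Z)\big)\,\mathrm dP^Y(y)}{\int_{\mathbb R}\mathrm{Var}(\mathbf 1_{\{Y\ge y\}})\,\mathrm dP^Y(y)},$$ and for $\mathbf Y=(Y_1,\dots,Y_q)$ with $\mathrm{Var}(Y_i)>0$ for all $i$ put $$T(\mathbf Y|\mathbf X)=\frac{\sum_{i=1}^q\big[\xi(Y_i|(\mathbf X,Y_{i-1},\dots,Y_1))-\xi(Y_i|(Y_{i-1},\dots,Y_1))\big]}{\sum_{i=1}^q\big[1-\xi(Y_i|(Y_{i-1},\dots,Y_1))\big]},\qquad \xi(Y_1|\emptyset):=0 .$$ A generalized inverse of a matrix $A$ is any matrix $A^-$ with $AA^-A=A$. Normal distributions may be singular. (1) If $(\mathbf X,Y)\sim N(\mathbf 0,\Sigma)$ with $\Sigma=\begin{pmatrix}\Sigma_{11}&\Sigma_{12}\\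 \Sigma_{21}&1\end{pmatrix}$, then, for every generalized inverse $\Sigma_{11}^-$ of $\Sigma_{11}$, $$\xi(Y|\mathbf X)=\frac3\pi\arcsin\Big(\frac{1+\rho^2}{2}\Big)-\frac12,\qquad \rho=\sqrt{\Sigma_{21}\Sigma_{11}^-\Sigma_{12}} .$$ (2) Consequently, let $(\mathbf X,\mathbf Y)\sim N(\mu,\Sigma)$ with $\mathbf Y=(Y_1,\dots,Y_q)$ and $\mathrm{Var}(Y_i)>0$ for all $i$. Put $g(\rho)=\frac3\pi\arcsin\big(\frac{1+\rho^2}{2}\big)-\frac12$. For $i\in\{1,\dots,q\}$ and a set $I$ of coordinates of $(\mathbf X,\mathbf Y)$, let $\rho_{i|I}=\sqrt{\Sigma_{i,I}\,\Sigma_{I,I}^-\,\Sigma_{I,i}/\mathrm{Var}(Y_i)}$, where $\Sigma_{I,I}$ is the covariance matrix of the coordinates in $I$, $\Sigma_{I,i}$ is the column of their covariances with $Y_i$, $\Sigma_{i,I}=\Sigma_{I,i}^{T}$, $\Sigma_{I,I}^-$ is any generalized inverse, and $\rho_{i|\emptyset}=0$. With $A_i$ the set of coordinates of $(\mathbf X,Y_1,\dots,Y_{i-1})$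 and $B_i$ that of $(Y_1,\dots,Y_{i-1})$, $$T(\mathbf Y|\mathbf X)=\frac{\sum_{i=1}^q\big[g(\rho_{i|A_i})-g(\rho_{i|B_i})\big]}{\sum_{i=1}^q\big[1-g(\rho_{i|B_i})\big]} .$$ -/

import Mathlib

open MeasureTheory ProbabilityTheory
open scoped Matrix

noncomputable section

/-- Chatterjee's rank correlation
`ξ(Y|X) = ∫ Var(P(Y ≥ y | X)) dP^Y(y) / ∫ Var(1_{Y ≥ y}) dP^Y(y)`,
where `P(Y ≥ y | X)` is the conditional probability given the σ-algebra generated by `X`. -/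
def chatterjeeXi {Ω E : Type*} [MeasurableSpace Ω] [MeasurableSpace E]
    (P : Measure Ω) (Y : Ω → ℝ) (X : Ω → E) : ℝ :=
  (∫ y, Var[P⟦{ω | y ≤ Y ω} | MeasurableSpace.comap X inferInstance⟧; P] ∂(P.map Y)) /
    (∫ y, Var[Set.indicator {ω | y ≤ Y ω} (fun _ => (1 : ℝ)); P] ∂(P.map Y))

/-- The vector of the responses `Y_j`, `j < i`, that precede `Y_i`. -/
def precedingResponses {Ω : Type*} {q : ℕ} (Y : Ω → Fin q → ℝ) (i : Fin q) :
    Ω → {j : Fin q // j < i} → ℝ :=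
  fun ω j => Y ω j

/-- The random vector `(U, V)` obtained by joining two random vectors. -/
def joinVec {Ω ι κ : Type*} (U : Ω → ι → ℝ) (V : Ω → κ → ℝ) : Ω → ι ⊕ κ → ℝ :=
  fun ω => Sum.elim (U ω) (V ω)

/-- `ξ(Y_i | (Y_{i-1}, …, Y_1))`, with the convention `ξ(Y_1 | ∅) = 0`. -/
def xiPreceding {Ω : Type*} [MeasurableSpace Ω] {q : ℕ} (P : Measure Ω)
    (Y : Ω → Fin q → ℝ) (i : Fin q) : ℝ :=
  if (i : ℕ) = 0 then 0 else chatterjeeXi P (fun ω => Y ω i) (precedingResponses Y i)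

/-- The measure of predictability `T(Y|X)` of a response vector `Y` given `X`. -/
def predictabilityT {Ω : Type*} [MeasurableSpace Ω] {p q : ℕ} (P : Measure Ω)
    (Y : Ω → Fin q → ℝ) (X : Ω → Fin p → ℝ) : ℝ :=
  (∑ i : Fin q, (chatterjeeXi P (fun ω => Y ω i) (joinVec X (precedingResponses Y i))
      - xiPreceding P Y i)) /
    ∑ i : Fin q, (1 - xiPreceding P Y i)

/-- `G` is a generalized inverse of `A`: `A G A = A`. -/
def IsGeneralizedInverse {m n : Type*} [Fintype m] [Fintype n]
    (A : Matrix m n ℝ) (G : Matrix n m ℝ) : Prop :=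
  A * G * A = A

/-- The random vector `Z` has the multivariate normal distribution `N(μ, S)`. (Part of this is
that `S` is symmetric and positive semidefinite; it may be singular.) -/
def IsMultivariateNormal {Ω ι : Type*} [MeasurableSpace Ω] [Fintype ι] [DecidableEq ι]
    (P : Measure Ω) (Z : Ω → ι → ℝ) (μ : ι → ℝ) (S : Matrix ι ι ℝ) : Prop :=
  S.PosSemidef ∧
    HasLaw (fun ω => WithLp.toLp 2 (Z ω)) (multivariateGaussian (WithLp.toLp 2 μ) S) P

/-- The function `ρ ↦ (3/π) arcsin((1 + ρ²)/2) - 1/2`. -/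
def gaussianXi (ρ : ℝ) : ℝ :=
  3 / Real.pi * Real.arcsin ((1 + ρ ^ 2) / 2) - 1 / 2

/-- For a covariance matrix `S`, the number `√(S_{k,e} G S_{e,k} / S_{k,k})`, where `e` lists the
indices of the predictors, `k` is the index of the response, and `G` is meant to be a generalized
inverse of the covariance matrix `S_{e,e}` of the predictors. -/
def multipleCorr {m n : Type*} [Fintype m] (S : Matrix n n ℝ) (e : m → n) (k : n)
    (G : Matrix m m ℝ) : ℝ :=
  √(((fun a => S k (e a)) ⬝ᵥ (G *ᵥ fun a => S (e a) k)) / S k k)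

/-- The indices of `(X, Y_1, …, Y_{i-1})` within `(X, Y)`. -/
def idxFull {p q : ℕ} (i : Fin q) : Fin p ⊕ {j : Fin q // j < i} → Fin p ⊕ Fin q :=
  Sum.map id Subtype.val

/-- The indices of `(Y_1, …, Y_{i-1})` within `(X, Y)`. -/
def idxPreceding {p q : ℕ} (i : Fin q) : {j : Fin q // j < i} → Fin p ⊕ Fin q :=
  fun j => Sum.inr j.val

end

/-! Regression splits the response as Y = f(Z) + R, with f affine in the predictors Z and R a
centred Gaussian independent of Z. Let a = Var f(Z) and b = Var R, so that ρ² = a/(a+b). Given Z,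
the probability of Y ≥ y is the Gaussian tail P(R ≥ y - f(Z)), and its square is the probability
that two conditionally independent copies of Y both exceed y. Averaging over Z, and over y drawn
from an independent copy of Y, gives the probability that two jointly Gaussian differences are both
nonnegative. Their correlation is (1+ρ²)/2, so this probability is 1/4 + arcsin((1+ρ²)/2)/(2π)
(`gaussian_orthant`, resting on `gaussianReal_prod_real_wedge`).

The degenerate cases b = 0 and a = 0 of the same formula give ∫ P(Y ≥ y) dP^Y = 1/2 and ∫ P(Y ≥ y)²
dP^Y = 1/3. Hence the denominator of ξ is 1/6, and ξ is 6 times the orthant probability minus 2.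

A singular covariance matrix does no harm: the covariances of predictors and response lie in the
range of the predictor block, so any generalized inverse solves the normal equations. The residual
is then uncorrelated with the predictors, hence independent of them by joint normality. The formula
for T applies this to each term. -/

/-! ### Gaussian measure of a planar wedge -/

theorem integral_Ioi_mul_exp_neg_sq_div_two :
    ∫ r in Set.Ioi (0 : ℝ), r * Real.exp (-(r ^ 2 / 2)) = 1 := by
  have h := integral_rpow_mul_exp_neg_mul_rpow (p := 2) (q := 1) (b := 1 / 2) (by norm_num)
    (by norm_num) (by norm_num)
  have e : ((1 : ℝ) / 2) ^ (-((1 : ℝ) + 1) / 2) = 2 := by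
    rw [show (-((1 : ℝ) + 1) / 2) = -1 by norm_num, Real.rpow_neg_one]; norm_num
  rw [e, show ((1 : ℝ) + 1) / 2 = 1 by norm_num, Real.Gamma_one] at h
  rw [show (2 : ℝ) * (1 / 2) * 1 = 1 by norm_num] at h
  rw [← h]
  refine setIntegral_congr_fun measurableSet_Ioi fun r _ => ?_
  simp only [Real.rpow_one, Real.rpow_two]
  congr 2
  ring

theorem gaussianPDFReal_std_mul (x y : ℝ) :
    gaussianPDFReal 0 1 x * gaussianPDFReal 0 1 y
      = (2 * Real.pi)⁻¹ * Real.exp (-((x ^ 2 + y ^ 2) / 2)) := by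
  simp only [gaussianPDFReal, NNReal.coe_one, mul_one, sub_zero]
  rw [mul_mul_mul_comm, ← Real.exp_add, ← mul_inv, Real.mul_self_sqrt (by positivity)]
  congr 2
  ring

theorem gaussianReal_prod_real_apply {s : Set (ℝ × ℝ)} (hs : MeasurableSet s) :
    ((gaussianReal 0 1).prod (gaussianReal 0 1)).real s
      = ∫ p : ℝ × ℝ, s.indicator
          (fun p => (2 * Real.pi)⁻¹ * Real.exp (-((p.1 ^ 2 + p.2 ^ 2) / 2))) p := by
  rw [integral_indicator hs, gaussianReal_of_var_ne_zero 0 one_ne_zero,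
    prod_withDensity (measurable_gaussianPDF 0 1) (measurable_gaussianPDF 0 1), Measure.real,
    withDensity_apply _ hs, ← Measure.volume_eq_prod,
    integral_eq_lintegral_of_nonneg_ae (Filter.Eventually.of_forall fun p => by positivity)
      (by fun_prop)]
  congr 1
  refine lintegral_congr fun p => ?_
  rw [gaussianPDF, gaussianPDF, ← ENNReal.ofReal_mul (gaussianPDFReal_nonneg _ _ _),
    gaussianPDFReal_std_mul]

/-- The standard Gaussian measure of a planar wedge with one side on the `y`-axis. -/
theorem gaussianReal_prod_real_wedge {c : ℝ} (hc0 : 0 ≤ c) (hc1 : c ≤ 1) :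
    ((gaussianReal 0 1).prod (gaussianReal 0 1)).real
        {p : ℝ × ℝ | 0 ≤ p.1 ∧ 0 ≤ c * p.1 + √(1 - c ^ 2) * p.2}
      = 1 / 4 + Real.arcsin c / (2 * Real.pi) := by
  have hπ := Real.pi_pos
  have hs : MeasurableSet {p : ℝ × ℝ | 0 ≤ p.1 ∧ 0 ≤ c * p.1 + √(1 - c ^ 2) * p.2} :=
    (measurableSet_le measurable_const measurable_fst).inter
      (measurableSet_le measurable_const
        (by fun_prop : Measurable fun p : ℝ × ℝ => c * p.1 + √(1 - c ^ 2) * p.2))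
  set β := Real.arcsin c with hβ
  have hβ0 : 0 ≤ β := Real.arcsin_nonneg.2 hc0
  have hβ1 : β ≤ Real.pi / 2 := Real.arcsin_le_pi_div_two c
  have hsin : Real.sin β = c := Real.sin_arcsin (by linarith) hc1
  have hcos : Real.cos β = √(1 - c ^ 2) := Real.cos_arcsin c
  rw [gaussianReal_prod_real_apply hs, ← integral_comp_polarCoord_symm, polarCoord_target]
  have key : ∀ p ∈ Set.Ioi (0 : ℝ) ×ˢ Set.Ioo (-Real.pi) Real.pi,
      p.1 • ({p : ℝ × ℝ | 0 ≤ p.1 ∧ 0 ≤ c * p.1 + √(1 - c ^ 2) * p.2}.indicator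
          (fun p => (2 * Real.pi)⁻¹ * Real.exp (-((p.1 ^ 2 + p.2 ^ 2) / 2)))
          (polarCoord.symm p))
        = (p.1 * Real.exp (-(p.1 ^ 2 / 2))) *
          (Set.Icc (-β) (Real.pi / 2)).indicator (fun _ => (2 * Real.pi)⁻¹) p.2 := by
    rintro ⟨r, φ⟩ ⟨hr, hφ1, hφ2⟩
    simp only [Set.mem_Ioi] at hr hφ1 hφ2
    -- With c = sin β the second linear form is r sin(φ + β), so the wedge is the sector -β ≤ φ ≤
    -- π/2, of opening π/2 + β.
    have hiff : polarCoord.symm (r, φ)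
          ∈ {p : ℝ × ℝ | 0 ≤ p.1 ∧ 0 ≤ c * p.1 + √(1 - c ^ 2) * p.2}
        ↔ φ ∈ Set.Icc (-β) (Real.pi / 2) := by
      have e : c * (r * Real.cos φ) + √(1 - c ^ 2) * (r * Real.sin φ)
          = r * Real.sin (φ + β) := by
        rw [Real.sin_add, hsin, hcos]; ring
      simp only [polarCoord_symm_apply, Set.mem_ofPred_eq, e, mul_nonneg_iff_of_pos_left hr,
        Set.mem_Icc]
      constructor
      · rintro ⟨h1, h2⟩
        have h3 : φ ≤ Real.pi / 2 := by
          by_contra h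
          exact absurd h1 (not_le.2 (Real.cos_neg_of_pi_div_two_lt_of_lt (not_le.1 h)
            (by linarith)))
        have h4 : -(Real.pi / 2) ≤ φ := by
          by_contra h
          have : Real.cos (-φ) < 0 :=
            Real.cos_neg_of_pi_div_two_lt_of_lt (by linarith [not_le.1 h]) (by linarith)
          rw [Real.cos_neg] at this
          linarith
        refine ⟨?_, h3⟩
        by_contra h
        exact absurd h2 (not_le.2 (Real.sin_neg_of_neg_of_neg_pi_lt (by linarith [not_le.1 h])
          (by linarith)))
      · rintro ⟨h1, h2⟩
        exact ⟨Real.cos_nonneg_of_mem_Icc ⟨by linarith, h2⟩,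
          Real.sin_nonneg_of_mem_Icc ⟨by linarith, by linarith⟩⟩
    by_cases h : φ ∈ Set.Icc (-β) (Real.pi / 2)
    · rw [Set.indicator_of_mem (hiff.2 h), Set.indicator_of_mem h]
      simp only [polarCoord_symm_apply, smul_eq_mul]
      rw [show (r * Real.cos φ) ^ 2 + (r * Real.sin φ) ^ 2 = r ^ 2 by
        rw [mul_pow, mul_pow, ← mul_add, Real.cos_sq_add_sin_sq, mul_one]]
      ring
    · rw [Set.indicator_of_notMem (fun h' => h (hiff.1 h')), Set.indicator_of_notMem h]
      simp
  rw [setIntegral_congr_fun (measurableSet_Ioi.prod measurableSet_Ioo) key,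
    Measure.volume_eq_prod, setIntegral_prod_mul (fun r => r * Real.exp (-(r ^ 2 / 2))),
    integral_Ioi_mul_exp_neg_sq_div_two, one_mul, setIntegral_indicator measurableSet_Icc,
    setIntegral_const, smul_eq_mul]
  have hae : Set.Ioo (-Real.pi) Real.pi ∩ Set.Icc (-β) (Real.pi / 2)
      = Set.Icc (-β) (Real.pi / 2) :=
    Set.inter_eq_right.2 fun x hx => ⟨by linarith [hx.1], by linarith [hx.2]⟩
  rw [hae, Measure.real, Real.volume_Icc, ENNReal.toReal_ofReal (by linarith)]
  field_simp
  ring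

/-! ### Gaussian orthant probability -/

theorem charFunDual_gaussianReal_eq (m : ℝ) (v : NNReal) (L : StrongDual ℝ ℝ) :
    charFunDual (gaussianReal m v) L
      = Complex.exp (((L 1 * m : ℝ) : ℂ) * Complex.I - ((v * L 1 ^ 2 / 2 : ℝ) : ℂ)) := by
  have hL : L m = L 1 * m := by
    conv_lhs => rw [show m = m • (1 : ℝ) by simp, map_smul]
    simp [mul_comm]
  rw [IsGaussian.charFunDual_eq, integral_complex_ofReal,
    integral_continuousLinearMap_gaussianReal,
    variance_continuousLinearMap_gaussianReal, hL, Real.coe_toNNReal _ (sq_nonneg _)]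
  congr 2
  push_cast
  ring

/-- The law of `(W + R - Y, W + U - Y)` for independent Gaussian variables `Y, W, R, U`. -/
theorem map_gaussian_differences (m : ℝ) (a b : NNReal) (hab : 0 < a + b) :
    ((gaussianReal m (a + b)).prod ((gaussianReal m a).prod
        ((gaussianReal 0 b).prod (gaussianReal 0 b)))).map
        (fun z : ℝ × ℝ × ℝ × ℝ => (z.2.1 + z.2.2.1 - z.1, z.2.1 + z.2.2.2 - z.1))
      = ((gaussianReal 0 1).prod (gaussianReal 0 1)).map
        (fun p : ℝ × ℝ => (√(2 * (a + b)) * p.1,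
          √(2 * (a + b)) * ((2 * a + b) / (2 * (a + b)) * p.1
            + √(1 - ((2 * a + b) / (2 * (a + b)) : ℝ) ^ 2) * p.2))) := by
  have hab' : (0 : ℝ) < a + b := by exact_mod_cast hab
  have ha : (0 : ℝ) ≤ a := a.2
  have hb : (0 : ℝ) ≤ b := b.2
  -- Both differences have variance 2(a+b); they share W - Y, so their covariance is a + (a+b). Thus
  -- c is their correlation.
  set c : ℝ := (2 * a + b) / (2 * (a + b)) with hc
  have hc0 : 0 ≤ c := by positivity
  have hc1 : c ≤ 1 := by rw [hc, div_le_one (by positivity)]; linarith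
  set s := √(2 * ((a : ℝ) + b)) with hs
  have hs2 : s ^ 2 = 2 * (a + b) := Real.sq_sqrt (by positivity)
  set d := √(1 - c ^ 2) with hd
  have hd2 : d ^ 2 = 1 - c ^ 2 := Real.sq_sqrt (by nlinarith)
  have hsc : s ^ 2 * c = 2 * a + b := by rw [hs2, hc]; field_simp
  let y : ℝ × ℝ × ℝ × ℝ →L[ℝ] ℝ := .fst ℝ ℝ _
  let w : ℝ × ℝ × ℝ × ℝ →L[ℝ] ℝ := (ContinuousLinearMap.fst ℝ ℝ _).comp (.snd ℝ ℝ _)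
  let r : ℝ × ℝ × ℝ × ℝ →L[ℝ] ℝ :=
    (ContinuousLinearMap.fst ℝ ℝ _).comp ((ContinuousLinearMap.snd ℝ ℝ _).comp (.snd ℝ ℝ _))
  let r' : ℝ × ℝ × ℝ × ℝ →L[ℝ] ℝ :=
    (ContinuousLinearMap.snd ℝ ℝ _).comp ((ContinuousLinearMap.snd ℝ ℝ _).comp (.snd ℝ ℝ _))
  let A : ℝ × ℝ × ℝ × ℝ →L[ℝ] ℝ × ℝ := (w + r - y).prod (w + r' - y)
  let B : ℝ × ℝ →L[ℝ] ℝ × ℝ := (s • ContinuousLinearMap.fst ℝ ℝ ℝ).prod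
    (s • (c • ContinuousLinearMap.fst ℝ ℝ ℝ + d • ContinuousLinearMap.snd ℝ ℝ ℝ))
  change Measure.map A _ = Measure.map B _
  have : IsProbabilityMeasure (Measure.map A ((gaussianReal m (a + b)).prod ((gaussianReal m a).prod
        ((gaussianReal 0 b).prod (gaussianReal 0 b))))) :=
    Measure.isProbabilityMeasure_map (by fun_prop)
  have : IsProbabilityMeasure (Measure.map B ((gaussianReal 0 1).prod (gaussianReal 0 1))) :=
    Measure.isProbabilityMeasure_map (by fun_prop)
  refine Measure.ext_of_charFunDual (funext fun L => ?_)
  have hL : ∀ u v : ℝ, L (u, v) = L (1, 0) * u + L (0, 1) * v := fun u v => by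
    have : ((u, v) : ℝ × ℝ) = u • ((1 : ℝ), (0 : ℝ)) + v • ((0 : ℝ), (1 : ℝ)) := by simp
    rw [this, map_add, map_smul, map_smul]
    simp [mul_comm]
  rw [charFunDual_map, charFunDual_map]
  simp only [charFunDual_prod, charFunDual_gaussianReal_eq, ← Complex.exp_add]
  congr 1
  simp only [ContinuousLinearMap.comp_apply, ContinuousLinearMap.inl_apply,
    ContinuousLinearMap.inr_apply, A, B, y, w, r, r', ContinuousLinearMap.prod_apply,
    add_apply, sub_apply, smul_apply, ContinuousLinearMap.coe_fst', ContinuousLinearMap.coe_snd',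
    smul_eq_mul]
  generalize hp : L (1, 0) = α at hL
  generalize hq : L (0, 1) = γ at hL
  simp only [hL, NNReal.coe_add, NNReal.coe_one]
  -- The real parts of the exponents compare the quadratic forms of the covariances; the imaginary
  -- parts compare the means, where m cancels.
  rw [Complex.ext_iff]
  constructor
  · simp [-Complex.ofReal_mul, -Complex.ofReal_add, -Complex.ofReal_div, -Complex.ofReal_pow,
      -Complex.ofReal_sub, -Complex.ofReal_neg]
    have h1 : (s * d) ^ 2 = s ^ 2 - s ^ 2 * c * c := by rw [mul_pow, hd2]; ring
    have e : (α * s + γ * (s * c)) ^ 2 + (γ * (s * d)) ^ 2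
        = α ^ 2 * s ^ 2 + γ ^ 2 * s ^ 2 + 2 * α * γ * (s ^ 2 * c) := by
      rw [mul_pow γ, h1]; ring
    rw [hsc, hs2] at e
    linarith
  · simp [-Complex.ofReal_mul, -Complex.ofReal_add, -Complex.ofReal_div, -Complex.ofReal_pow,
      -Complex.ofReal_sub, -Complex.ofReal_neg]
    ring

/-- `P(W + R ≥ Y, W + U ≥ Y)` for independent Gaussian variables `Y, W, R, U`, where `R, U` are
identically distributed, written as an iterated integral. -/
theorem gaussian_orthant (m : ℝ) (a b : NNReal) (hab : 0 < a + b) :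
    ∫ y, ∫ w, (gaussianReal 0 b).real (Set.Ici (y - w)) ^ 2 ∂gaussianReal m a
        ∂gaussianReal m (a + b)
      = 1 / 4 + Real.arcsin ((1 + a / (a + b)) / 2) / (2 * Real.pi) := by
  have hab' : (0 : ℝ) < a + b := by exact_mod_cast hab
  have ha : (0 : ℝ) ≤ a := a.2
  have hb : (0 : ℝ) ≤ b := b.2
  have hc : (1 + (a : ℝ) / (a + b)) / 2 = (2 * a + b) / (2 * (a + b)) := by field_simp; ring
  have hmap := map_gaussian_differences m a b hab
  have hQ : MeasurableSet (Set.Ici (0 : ℝ) ×ˢ Set.Ici (0 : ℝ)) :=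
    measurableSet_Ici.prod measurableSet_Ici
  have h := congrArg (fun μ => μ.real (Set.Ici (0 : ℝ) ×ˢ Set.Ici (0 : ℝ))) hmap
  rw [map_measureReal_apply (by fun_prop) hQ, map_measureReal_apply (by fun_prop) hQ] at h
  rw [hc, ← gaussianReal_prod_real_wedge (by positivity)
    (by rw [div_le_one (by positivity)]; linarith)]
  have hset : (fun p : ℝ × ℝ => (√(2 * (a + b)) * p.1,
          √(2 * (a + b)) * ((2 * a + b) / (2 * (a + b)) * p.1
            + √(1 - ((2 * a + b) / (2 * (a + b)) : ℝ) ^ 2) * p.2))) ⁻¹'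
          (Set.Ici (0 : ℝ) ×ˢ Set.Ici (0 : ℝ))
      = {p : ℝ × ℝ | 0 ≤ p.1 ∧ 0 ≤ (2 * a + b : ℝ) / (2 * (a + b)) * p.1
          + √(1 - ((2 * a + b : ℝ) / (2 * (a + b))) ^ 2) * p.2} := by
    ext p
    have hs : 0 < √(2 * ((a : ℝ) + b)) := Real.sqrt_pos.2 (by positivity)
    simp only [Set.mem_preimage, Set.mem_prod, Set.mem_Ici, Set.mem_ofPred_eq,
      mul_nonneg_iff_of_pos_left hs]
  rw [hset] at h
  rw [← h]
  set T := (fun z : ℝ × ℝ × ℝ × ℝ => (z.2.1 + z.2.2.1 - z.1, z.2.1 + z.2.2.2 - z.1)) ⁻¹'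
    (Set.Ici (0 : ℝ) ×ˢ Set.Ici (0 : ℝ)) with hT
  have hTm : MeasurableSet T := hQ.preimage (by fun_prop)
  rw [← integral_indicator_one hTm, integral_prod _ ((integrable_const 1).indicator hTm)]
  congr 1
  ext y
  have hTy : MeasurableSet (Prod.mk y ⁻¹' T) := hTm.preimage (by fun_prop)
  have e1 : (fun z => T.indicator (1 : ℝ × ℝ × ℝ × ℝ → ℝ) (y, z))
      = (Prod.mk y ⁻¹' T).indicator 1 := rfl
  rw [e1, integral_prod _ ((integrable_const 1).indicator hTy)]
  congr 1
  ext w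
  have hTw : MeasurableSet (Prod.mk w ⁻¹' (Prod.mk y ⁻¹' T)) := hTy.preimage (by fun_prop)
  have e2 : (fun z => (Prod.mk y ⁻¹' T).indicator (1 : ℝ × ℝ × ℝ → ℝ) (w, z))
      = (Prod.mk w ⁻¹' (Prod.mk y ⁻¹' T)).indicator 1 := rfl
  rw [e2, integral_indicator_one hTw]
  -- For fixed y and w the two constraints decouple into the same condition on R and on U, whence
  -- the square.
  have e3 : Prod.mk w ⁻¹' (Prod.mk y ⁻¹' T) = Set.Ici (y - w) ×ˢ Set.Ici (y - w) := by
    ext ⟨u, v⟩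
    simp only [hT, Set.mem_preimage, Set.mem_prod, Set.mem_Ici]
    constructor <;> rintro ⟨h1, h2⟩ <;> constructor <;> linarith
  rw [e3, measureReal_prod_prod, sq]

/-! ### Conditional survival functions and ξ for an independent Gaussian sum -/

theorem measurable_real_Ici_sub {E : Type*} [MeasurableSpace E] (ν : Measure ℝ) [SFinite ν]
    {g : E → ℝ} (hg : Measurable g) : Measurable fun z => ν.real (Set.Ici (g z)) := by
  have hs : MeasurableSet {p : E × ℝ | g p.1 ≤ p.2} :=
    measurableSet_le (hg.comp measurable_fst) measurable_snd
  exact (measurable_measure_prodMk_left (ν := ν) hs).ennreal_toReal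

/-- The conditional survival function of `f(Z) + R` given `Z`, for `R` independent of `Z`. -/
theorem condExp_le_add_of_indepFun {Ω E : Type*} [MeasurableSpace Ω] [MeasurableSpace E]
    {P : Measure Ω} [IsProbabilityMeasure P] {Z : Ω → E} {R : Ω → ℝ} {f : E → ℝ}
    (hZ : Measurable Z) (hR : Measurable R) (hf : Measurable f) (hind : Z ⟂ᵢ[P] R) (y : ℝ) :
    P⟦{ω | y ≤ f (Z ω) + R ω} | MeasurableSpace.comap Z inferInstance⟧
      =ᵐ[P] fun ω => (P.map R).real (Set.Ici (y - f (Z ω))) := by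
  have : IsProbabilityMeasure (P.map R) := Measure.isProbabilityMeasure_map hR.aemeasurable
  have : IsProbabilityMeasure (P.map Z) := Measure.isProbabilityMeasure_map hZ.aemeasurable
  have hg : Measurable fun z => (P.map R).real (Set.Ici (y - f z)) :=
    measurable_real_Ici_sub _ (measurable_const.sub hf)
  have hA : MeasurableSet {ω | y ≤ f (Z ω) + R ω} :=
    measurableSet_le measurable_const ((hf.comp hZ).add hR)
  have hgi : Integrable (fun z => (P.map R).real (Set.Ici (y - f z))) (P.map Z) :=
    Integrable.of_bound hg.aestronglyMeasurable 1
      (Filter.Eventually.of_forall fun z => by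
        rw [Real.norm_of_nonneg measureReal_nonneg]; exact measureReal_le_one)
  refine (ae_eq_condExp_of_forall_setIntegral_eq hZ.comap_le
    ((integrable_const (1 : ℝ)).indicator hA) (fun s _ _ => ?_) ?_ ?_).symm
  · exact (hgi.comp_measurable hZ).integrableOn
  -- Sets of the σ-algebra of Z are preimages of some B; by independence (Z, R) has a product law,
  -- and Fubini integrates R out first.
  · rintro s ⟨B, hB, rfl⟩ -
    rw [← setIntegral_map hB hg.aestronglyMeasurable hZ.aemeasurable,
      setIntegral_indicator hA, setIntegral_const, smul_eq_mul, mul_one]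
    have hC : MeasurableSet {p : E × ℝ | p.1 ∈ B ∧ y ≤ f p.1 + p.2} :=
      (measurable_fst hB).inter
        (measurableSet_le measurable_const ((hf.comp measurable_fst).add measurable_snd))
    have e : Z ⁻¹' B ∩ {ω | y ≤ f (Z ω) + R ω}
        = (fun ω => (Z ω, R ω)) ⁻¹' {p : E × ℝ | p.1 ∈ B ∧ y ≤ f p.1 + p.2} := rfl
    rw [e, ← map_measureReal_apply (hZ.prodMk hR) hC,
      (indepFun_iff_map_prod_eq_prod_map_map hZ.aemeasurable hR.aemeasurable).1 hind,
      ← integral_indicator_one hC, integral_prod _ ((integrable_const 1).indicator hC),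
      ← integral_indicator hB]
    refine integral_congr_ae (Filter.Eventually.of_forall fun z => ?_)
    have hCz : MeasurableSet (Prod.mk z ⁻¹' {p : E × ℝ | p.1 ∈ B ∧ y ≤ f p.1 + p.2}) :=
      hC.preimage (by fun_prop)
    change _ = ∫ r, (Prod.mk z ⁻¹' {p : E × ℝ | p.1 ∈ B ∧ y ≤ f p.1 + p.2}).indicator 1 r ∂_
    rw [integral_indicator_one hCz]
    by_cases hz : z ∈ B
    · rw [Set.indicator_of_mem hz]
      congr 1
      ext r
      simp [hz, add_comm]
    · rw [Set.indicator_of_notMem hz]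
      simp [hz]
  · exact (hg.comp (comap_measurable Z)).stronglyMeasurable.aestronglyMeasurable

theorem integrable_integral_real_Ici_sq (μ ν ρ : Measure ℝ) [IsProbabilityMeasure μ]
    [IsProbabilityMeasure ν] [IsProbabilityMeasure ρ] :
    Integrable (fun y => ∫ w, ν.real (Set.Ici (y - w)) ^ 2 ∂μ) ρ := by
  have hm : Measurable fun p : ℝ × ℝ => ν.real (Set.Ici (p.1 - p.2)) ^ 2 :=
    (measurable_real_Ici_sub ν (measurable_fst.sub measurable_snd)).pow_const 2
  refine Integrable.of_bound
    (hm.stronglyMeasurable.integral_prod_right' (ν := μ)).aestronglyMeasurable 1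
    (Filter.Eventually.of_forall fun y => ?_)
  refine (norm_integral_le_of_norm_le_const (C := 1)
    (Filter.Eventually.of_forall fun w => ?_)).trans (by simp)
  rw [Real.norm_of_nonneg (by positivity)]
  exact pow_le_one₀ measureReal_nonneg measureReal_le_one

/-- Without a residual the conditional survival probability is an indicator, which equals its own
square. -/
theorem integral_dirac_real_Ici_sq (ν : Measure ℝ) (y : ℝ) :
    ∫ w, (Measure.dirac (0 : ℝ)).real (Set.Ici (y - w)) ^ 2 ∂ν = ν.real (Set.Ici y) := by
  rw [← integral_indicator_one measurableSet_Ici]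
  congr 1
  ext w
  by_cases h : y ≤ w
  · simp [Measure.real, Set.indicator, h]
  · simp [Measure.real, Set.indicator, h]

theorem arcsin_one_half : Real.arcsin (1 / 2) = Real.pi / 6 := by
  rw [← Real.sin_pi_div_six, Real.arcsin_sin] <;> linarith [Real.pi_pos]

/-- The case b = 0 of `gaussian_orthant`, where the correlation is 1. -/
theorem integral_gaussian_real_Ici (m : ℝ) {v : NNReal} (hv : 0 < v) :
    ∫ y, (gaussianReal m v).real (Set.Ici y) ∂gaussianReal m v = 1 / 2 := by
  have h := gaussian_orthant m v 0 (by simpa using hv)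
  simp only [gaussianReal_zero_var, integral_dirac_real_Ici_sq, add_zero, NNReal.coe_zero] at h
  have hv' : (v : ℝ) ≠ 0 := by exact_mod_cast hv.ne'
  rw [h, div_self hv', show ((1 : ℝ) + 1) / 2 = 1 by norm_num, Real.arcsin_one]
  field_simp
  norm_num

theorem gaussian_real_Ici_sub (m y : ℝ) (v : NNReal) :
    (gaussianReal 0 v).real (Set.Ici (y - m)) = (gaussianReal m v).real (Set.Ici y) := by
  have h := gaussianReal_map_add_const (μ := 0) (v := v) m
  rw [zero_add] at h
  rw [← h, map_measureReal_apply (by fun_prop) measurableSet_Ici]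
  congr 1
  ext x
  simp

/-- The case a = 0 of `gaussian_orthant`: W is the constant m and the correlation is 1/2. -/
theorem integral_gaussian_real_Ici_sq (m : ℝ) {v : NNReal} (hv : 0 < v) :
    ∫ y, (gaussianReal m v).real (Set.Ici y) ^ 2 ∂gaussianReal m v = 1 / 3 := by
  have h := gaussian_orthant m 0 v (by simpa using hv)
  simp only [gaussianReal_zero_var, integral_dirac, gaussian_real_Ici_sub, zero_add,
    NNReal.coe_zero, zero_div, add_zero, arcsin_one_half] at h
  rw [h]
  field_simp
  norm_num

/-- Expanding each variance as second moment minus squared mean reduces ξ to (orthant probability -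
1/3) / (1/2 - 1/3). -/
theorem chatterjeeXi_add_of_indepFun_of_gaussian {Ω E : Type*} [MeasurableSpace Ω]
    [MeasurableSpace E] {P : Measure Ω} [IsProbabilityMeasure P] {Z : Ω → E} {R : Ω → ℝ}
    {f : E → ℝ} (hZ : Measurable Z) (hR : Measurable R) (hf : Measurable f)
    (hind : Z ⟂ᵢ[P] R) {m : ℝ} {a b : NNReal} (hab : 0 < a + b)
    (hfZ : P.map (fun ω => f (Z ω)) = gaussianReal m a) (hRlaw : P.map R = gaussianReal 0 b) :
    chatterjeeXi P (fun ω => f (Z ω) + R ω) Z = gaussianXi √(a / (a + b)) := by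
  have hYm : Measurable fun ω => f (Z ω) + R ω := (hf.comp hZ).add hR
  have hYlaw : P.map (fun ω => f (Z ω) + R ω) = gaussianReal m (a + b) := by
    have := gaussianReal_add_gaussianReal_of_indepFun
      (hind.comp (φ := f) (ψ := id) hf measurable_id) hfZ hRlaw
    rwa [add_zero] at this
  have hpy : ∀ y, P.real {ω | y ≤ f (Z ω) + R ω} = (gaussianReal m (a + b)).real (Set.Ici y) :=
    fun y => by
      rw [← hYlaw, map_measureReal_apply hYm measurableSet_Ici]; rfl
  have hA : ∀ y, MeasurableSet {ω | y ≤ f (Z ω) + R ω} :=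
    fun y => measurableSet_le measurable_const hYm
  have hnum : ∀ y, Var[P⟦{ω | y ≤ f (Z ω) + R ω} | MeasurableSpace.comap Z inferInstance⟧; P]
      = ∫ w, (gaussianReal 0 b).real (Set.Ici (y - w)) ^ 2 ∂gaussianReal m a
        - (gaussianReal m (a + b)).real (Set.Ici y) ^ 2 := by
    intro y
    have hce := condExp_le_add_of_indepFun hZ hR hf hind y
    have hgm : Measurable fun w => (gaussianReal 0 b).real (Set.Ici (y - w)) :=
      measurable_real_Ici_sub _ (measurable_const.sub measurable_id)
    -- The mean to be squared in the variance is P(Y ≥ y), by the tower property.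
    have hmean := integral_condExp (μ := P) hZ.comap_le
      (f := Set.indicator {ω | y ≤ f (Z ω) + R ω} (fun _ => (1 : ℝ)))
    rw [integral_congr_ae hce, hRlaw] at hmean
    rw [variance_congr hce, hRlaw, variance_eq_sub, hmean,
      integral_indicator_const _ (hA y), hpy, smul_eq_mul, mul_one, ← hfZ,
      integral_map (show AEMeasurable (fun ω => f (Z ω)) P from (hf.comp hZ).aemeasurable)
        (hgm.pow_const 2).aestronglyMeasurable]
    · rfl
    · refine MemLp.of_bound (hgm.comp (hf.comp hZ)).aestronglyMeasurable 1
        (Filter.Eventually.of_forall fun ω => ?_)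
      rw [Real.norm_of_nonneg measureReal_nonneg]
      exact measureReal_le_one
  have hden : ∀ y, Var[Set.indicator {ω | y ≤ f (Z ω) + R ω} (fun _ => (1 : ℝ)); P]
      = (gaussianReal m (a + b)).real (Set.Ici y)
        - (gaussianReal m (a + b)).real (Set.Ici y) ^ 2 := by
    intro y
    have hsq : (Set.indicator {ω | y ≤ f (Z ω) + R ω} (fun _ => (1 : ℝ))) ^ 2
        = Set.indicator {ω | y ≤ f (Z ω) + R ω} (fun _ => (1 : ℝ)) := by
      ext ω
      by_cases h : y ≤ f (Z ω) + R ω <;> simp [Set.indicator, h]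
    rw [variance_eq_sub (memLp_indicator_const 2 (hA y) 1 (Or.inr (measure_ne_top _ _))), hsq,
      integral_indicator_const _ (hA y), hpy, smul_eq_mul, mul_one]
  have hi1 := integrable_integral_real_Ici_sq (gaussianReal m a) (gaussianReal 0 b)
    (gaussianReal m (a + b))
  have hpm : Measurable fun y => (gaussianReal m (a + b)).real (Set.Ici y) :=
    measurable_real_Ici_sub _ measurable_id
  have hi2 : Integrable (fun y => (gaussianReal m (a + b)).real (Set.Ici y))
      (gaussianReal m (a + b)) :=
    Integrable.of_bound hpm.aestronglyMeasurable 1 (Filter.Eventually.of_forall fun y => by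
      rw [Real.norm_of_nonneg measureReal_nonneg]; exact measureReal_le_one)
  have hi3 : Integrable (fun y => (gaussianReal m (a + b)).real (Set.Ici y) ^ 2)
      (gaussianReal m (a + b)) :=
    Integrable.of_bound (hpm.pow_const 2).aestronglyMeasurable 1
      (Filter.Eventually.of_forall fun y => by
        rw [Real.norm_of_nonneg (by positivity)]
        exact pow_le_one₀ measureReal_nonneg measureReal_le_one)
  rw [chatterjeeXi, hYlaw]
  simp only [hnum, hden]
  rw [integral_sub hi1 hi3, integral_sub hi2 hi3, gaussian_orthant m a b hab,
    integral_gaussian_real_Ici m hab, integral_gaussian_real_Ici_sq m hab, gaussianXi,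
    Real.sq_sqrt (by positivity)]
  field_simp
  ring

/-! ### Regression inside a possibly singular Gaussian vector -/

/-- For a positive semidefinite matrix, the off-diagonal column `S_{e,k}` lies in the range of the
block `S_{e,e}`, so that any generalized inverse of this block solves the normal equations. -/
theorem Matrix.PosSemidef.submatrix_mulVec_generalizedInverse {m n : Type*} [Fintype m]
    [Fintype n] [DecidableEq n] {S : Matrix n n ℝ} (hS : S.PosSemidef) (e : m → n) (k : n)
    {G : Matrix m m ℝ} (hG : IsGeneralizedInverse (S.submatrix e e) G) :
    S.submatrix e e *ᵥ (G *ᵥ fun a => S (e a) k) = fun a => S (e a) k := by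
  classical
  obtain ⟨B, rfl⟩ : ∃ B : Matrix n n ℝ, S = Bᴴ * B := by
    open scoped MatrixOrder in
    exact CStarAlgebra.nonneg_iff_eq_star_mul_self.1 hS.nonneg
  set E : Matrix n m ℝ := B.submatrix id e with hE
  have hK : (Bᴴ * B).submatrix e e = Eᴴ * E := by
    ext i j
    simp [hE, Matrix.mul_apply]
  have hs : (fun a => (Bᴴ * B) (e a) k) = Eᴴ *ᵥ fun i => B i k := by
    ext i
    simp [hE, Matrix.mul_apply, Matrix.mulVec, dotProduct]
  rw [IsGeneralizedInverse, hK] at hG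
  -- In a product M Eᴴ E = 0 the right factor E can be cancelled, leaving M Eᴴ = 0; the column in
  -- question is Eᴴ applied to a vector.
  have h0 : (Eᴴ * E * G - 1) * (Eᴴ * E) = 0 := by
    rw [Matrix.sub_mul, hG, Matrix.one_mul, sub_self]
  rw [Matrix.mul_conjTranspose_mul_self_eq_zero, Matrix.sub_mul, Matrix.one_mul, sub_eq_zero] at h0
  rw [hK, hs, Matrix.mulVec_mulVec, Matrix.mulVec_mulVec, h0]

namespace IsMultivariateNormal

variable {Ω n : Type*} [MeasurableSpace Ω] [Fintype n] [DecidableEq n] {P : Measure Ω}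
  {Z : Ω → n → ℝ} {μ : n → ℝ} {S : Matrix n n ℝ}

theorem hasGaussianLaw (h : IsMultivariateNormal P Z μ S) : HasGaussianLaw Z P :=
  h.2.hasGaussianLaw.map_equiv (PiLp.continuousLinearEquiv 2 ℝ fun _ : n => ℝ)

theorem covariance_eval (h : IsMultivariateNormal P Z μ S) (i j : n) :
    cov[fun ω => Z ω i, fun ω => Z ω j; P] = S i j := by
  rw [← covariance_eval_multivariateGaussian (μ := WithLp.toLp 2 μ) h.1 i j,
    ← h.2.covariance_comp (by fun_prop) (by fun_prop)]
  rfl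

end IsMultivariateNormal

/-- The rank correlation of a non-degenerate coordinate of a Gaussian vector given other
coordinates. -/
theorem chatterjeeXi_of_isMultivariateNormal {Ω m n : Type*} [MeasurableSpace Ω] [Fintype m]
    [Fintype n] [DecidableEq n] {P : Measure Ω} [IsProbabilityMeasure P] {Z : Ω → n → ℝ}
    (hZ : Measurable Z) {μ : n → ℝ} {S : Matrix n n ℝ} (h : IsMultivariateNormal P Z μ S)
    (e : m → n) (k : n) (hk : 0 < S k k) {G : Matrix m m ℝ}
    (hG : IsGeneralizedInverse (S.submatrix e e) G) :
    chatterjeeXi P (fun ω => Z ω k) (fun ω a => Z ω (e a))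
      = gaussianXi (multipleCorr S e k G) := by
  have hgauss := h.hasGaussianLaw
  have hL2 : ∀ i, MemLp (fun ω => Z ω i) 2 P := fun i => (hgauss.eval i).memLp_two
  have hZi : ∀ i, Measurable fun ω => Z ω i := fun i => (measurable_pi_apply i).comp hZ
  have hsymm : ∀ i j, S i j = S j i := fun i j => by
    rw [← h.covariance_eval, ← h.covariance_eval, covariance_comm]
  set s : m → ℝ := fun a => S (e a) k with hs
  set b : m → ℝ := G *ᵥ s
  have hnormal : ∀ a, ∑ j, S (e a) (e j) * b j = S (e a) k := fun a =>
    congrFun (h.1.submatrix_mulVec_generalizedInverse e k hG) a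
  set X : Ω → m → ℝ := fun ω a => Z ω (e a) with hX
  have hXm : Measurable X := measurable_pi_lambda _ fun a => hZi (e a)
  set W : Ω → ℝ := fun ω => ∑ a, b a * Z ω (e a) with hW
  have hWL2 : MemLp W 2 P := memLp_finsetSum _ fun a _ => (hL2 (e a)).const_mul (b a)
  have hcovW : ∀ i, cov[fun ω => Z ω i, W; P] = ∑ a, S i (e a) * b a := fun i => by
    rw [hW, covariance_fun_sum_right (fun a => (hL2 (e a)).const_mul (b a)) (hL2 i)]
    simp only [covariance_const_mul_right, h.covariance_eval]
    exact Finset.sum_congr rfl fun a _ => mul_comm _ _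
  have hvarW : Var[W; P] = s ⬝ᵥ b := by
    rw [← covariance_self hWL2.aemeasurable]
    conv_lhs => enter [1]; rw [hW]
    rw [covariance_fun_sum_left (fun a => (hL2 (e a)).const_mul (b a)) hWL2]
    simp only [covariance_const_mul_left, hcovW, hnormal]
    simp only [dotProduct, hs, mul_comm]
  -- The mean of the residual is moved into the affine function f, so that R is centred.
  set δ : ℝ := P[fun ω => Z ω k - W ω]
  set R : Ω → ℝ := fun ω => Z ω k - W ω - δ with hR
  have hWm : Measurable W := Finset.measurable_sum _ fun a _ => (hZi (e a)).const_mul (b a)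
  have hRm : Measurable R := ((hZi k).sub hWm).sub_const δ
  let LX : (n → ℝ) →L[ℝ] (m → ℝ) := .pi fun a => .proj (e a)
  let LW : (n → ℝ) →L[ℝ] ℝ := ∑ a, b a • ContinuousLinearMap.proj (e a)
  let LD : (n → ℝ) →L[ℝ] ℝ := .proj k - LW
  have hLW : ∀ ω, LW (Z ω) = W ω := fun ω => by simp [LW, hW]
  have hD : (fun ω => Z ω k - W ω) = LD ∘ Z := by
    ext ω; simp [LD, hLW]
  have hWg : HasGaussianLaw W P := by
    have : W = LW ∘ Z := by ext ω; simp [hLW]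
    rw [this]; exact hgauss.map LW
  have hDg : HasGaussianLaw (fun ω => Z ω k - W ω) P := hD ▸ hgauss.map _
  have hDL2 := hDg.memLp_two
  have hind0 : X ⟂ᵢ[P] fun ω => Z ω k - W ω := by
    -- The covariance criterion for independence concerns two families, so the residual is viewed as
    -- a family over `Unit`; its covariances with the predictors vanish by the normal equations.
    have hjoint : HasGaussianLaw
        (fun ω => (fun a => Z ω (e a), fun _ : Unit => Z ω k - W ω)) P := by
      have : (fun ω => ((fun a => Z ω (e a) : m → ℝ), (fun _ : Unit => Z ω k - W ω)))
          = (LX.prod (.pi fun _ : Unit => LD)) ∘ Z := by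
        ext ω <;> simp [hLW, LX, LD]
      rw [this]; exact hgauss.map _
    have := HasGaussianLaw.indepFun_of_covariance_eval (X := fun a ω => Z ω (e a))
      (Y := fun (_ : Unit) ω => Z ω k - W ω) hjoint fun a _ => by
        rw [covariance_fun_sub_right (hL2 _) (hL2 _) hWL2, hcovW, hnormal, h.covariance_eval,
          sub_self]
    exact this.comp measurable_id (measurable_pi_apply ())
  have hind : X ⟂ᵢ[P] R := hind0.comp measurable_id (measurable_id.sub_const δ)
  let f : (m → ℝ) → ℝ := fun x => ∑ a, b a * x a + δ
  have hf : Measurable f := by fun_prop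
  have hvarD : Var[fun ω => Z ω k - W ω; P] = S k k - s ⬝ᵥ b := by
    have hkW : cov[fun ω => Z ω k, W; P] = s ⬝ᵥ b := by
      rw [hcovW]; simp only [dotProduct, hs, hsymm k]
    rw [← covariance_self hDL2.aemeasurable,
      covariance_fun_sub_fun_sub (hL2 k) hWL2 (hL2 k) hWL2, h.covariance_eval,
      covariance_comm W, hkW, covariance_self hWL2.aemeasurable, hvarW]
    ring
  have hRlaw : P.map R = gaussianReal 0 (S k k - s ⬝ᵥ b).toNNReal := by
    have h1 := hDg.map_eq_gaussianReal
    have h2 : P.map R = (P.map fun ω => Z ω k - W ω).map (fun x => x - δ) := by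
      rw [Measure.map_map (by fun_prop)
        (show Measurable fun ω => Z ω k - W ω from (hZi k).sub hWm)]; rfl
    rw [h2, h1, gaussianReal_map_sub_const, hvarD, sub_self]
  have hWlaw : P.map (fun ω => f (X ω)) = gaussianReal (P[W] + δ) (s ⬝ᵥ b).toNNReal := by
    have h1 := hWg.map_eq_gaussianReal
    have h2 : P.map (fun ω => f (X ω)) = (P.map W).map (fun x => x + δ) := by
      rw [Measure.map_map (by fun_prop) hWm]; rfl
    rw [h2, h1, gaussianReal_map_add_const, hvarW]
  -- Both numbers are variances, so the truncation in `toNNReal` loses nothing.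
  have ha0 : 0 ≤ s ⬝ᵥ b := hvarW ▸ variance_nonneg _ _
  have hb0 : 0 ≤ S k k - s ⬝ᵥ b := hvarD ▸ variance_nonneg _ _
  have hsum : ((s ⬝ᵥ b).toNNReal : ℝ) + ((S k k - s ⬝ᵥ b).toNNReal : ℝ) = S k k := by
    rw [Real.coe_toNNReal _ ha0, Real.coe_toNNReal _ hb0]; ring
  have hpos : 0 < (s ⬝ᵥ b).toNNReal + (S k k - s ⬝ᵥ b).toNNReal := by
    rw [← NNReal.coe_pos, NNReal.coe_add, hsum]; exact hk
  have key := chatterjeeXi_add_of_indepFun_of_gaussian hXm hRm hf hind hpos hWlaw hRlaw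
  have hY : (fun ω => f (X ω) + R ω) = fun ω => Z ω k := by
    ext ω; simp only [f, hR, hX, hW]; ring
  have hrow : (fun a => S k (e a)) = s := funext fun a => hsymm k (e a)
  rw [hY, hsum, Real.coe_toNNReal _ ha0] at key
  rw [key, multipleCorr, hrow]

/-! ### Closed forms of ξ and T -/

theorem gaussianXi_zero : gaussianXi 0 = 0 := by
  rw [gaussianXi, show (1 + (0 : ℝ) ^ 2) / 2 = 1 / 2 by norm_num, arcsin_one_half]
  field_simp
  norm_num

theorem mainTheorem7 {Ω : Type*} [MeasurableSpace Ω] (P : Measure Ω) [IsProbabilityMeasure P]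
    {p : ℕ} (X : Ω → Fin p → ℝ) (hX : Measurable X) :
    -- the rank correlation `ξ` for a single response `Y` with variance `1`
    (∀ (Y : Ω → ℝ), Measurable Y →
      ∀ (S₁₁ : Matrix (Fin p) (Fin p) ℝ) (S₁₂ : Matrix (Fin p) Unit ℝ)
        (S₂₁ : Matrix Unit (Fin p) ℝ),
      IsMultivariateNormal P (joinVec X (fun ω (_ : Unit) => Y ω)) 0
        (Matrix.fromBlocks S₁₁ S₁₂ S₂₁ (1 : Matrix Unit Unit ℝ)) →
      ∀ G : Matrix (Fin p) (Fin p) ℝ, IsGeneralizedInverse S₁₁ G →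
      ∀ ρ : ℝ, ρ = √((S₂₁ * G * S₁₂) () ()) →
        chatterjeeXi P Y X
          = 3 / Real.pi * Real.arcsin ((1 + ρ ^ 2) / 2) - 1 / 2) ∧
    -- the resulting closed form of `T` for a response vector `Y` with non-degenerate components
    (∀ {q : ℕ} (Y : Ω → Fin q → ℝ), Measurable Y →
      ∀ (μ : Fin p ⊕ Fin q → ℝ) (S : Matrix (Fin p ⊕ Fin q) (Fin p ⊕ Fin q) ℝ),
      IsMultivariateNormal P (joinVec X Y) μ S →
      (∀ i : Fin q, 0 < S (Sum.inr i) (Sum.inr i)) →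
      ∀ (G : (i : Fin q) → Matrix (Fin p ⊕ {j : Fin q // j < i}) (Fin p ⊕ {j : Fin q // j < i}) ℝ)
        (H : (i : Fin q) → Matrix {j : Fin q // j < i} {j : Fin q // j < i} ℝ),
      (∀ i, IsGeneralizedInverse (S.submatrix (idxFull i) (idxFull i)) (G i)) →
      (∀ i, IsGeneralizedInverse (S.submatrix (idxPreceding i) (idxPreceding i)) (H i)) →
        predictabilityT P Y X
          = (∑ i : Fin q, (gaussianXi (multipleCorr S (idxFull i) (Sum.inr i) (G i))
                - gaussianXi (multipleCorr S (idxPreceding i) (Sum.inr i) (H i)))) /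
            ∑ i : Fin q, (1 - gaussianXi (multipleCorr S (idxPreceding i) (Sum.inr i) (H i)))) := by
  refine ⟨?_, ?_⟩
  · intro Y hY S₁₁ S₁₂ S₂₁ h G hG ρ hρ
    have hXY : Measurable (joinVec X fun ω (_ : Unit) => Y ω) := by
      refine measurable_pi_lambda _ fun i => ?_
      rcases i with i | i
      · exact (measurable_pi_apply i).comp hX
      · exact hY
    have key := chatterjeeXi_of_isMultivariateNormal hXY h Sum.inl (Sum.inr ())
      (by simp) (G := G) (show IsGeneralizedInverse S₁₁ G from hG)
    -- The response has variance 1, so the normalization in `multipleCorr` disappears.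
    have hρ' : ρ = multipleCorr (Matrix.fromBlocks S₁₁ S₁₂ S₂₁ (1 : Matrix Unit Unit ℝ)) Sum.inl
        (Sum.inr ()) G := by
      rw [hρ, multipleCorr, Matrix.mul_assoc]
      simp [Matrix.mul_apply, dotProduct, Matrix.mulVec]
    rw [← hρ'] at key
    exact key
  · intro q Y hY μ S h hpos G H hG hH
    have hXY : Measurable (joinVec X Y) := by
      refine measurable_pi_lambda _ fun i => ?_
      rcases i with i | i
      · exact (measurable_pi_apply i).comp hX
      · exact (measurable_pi_apply i).comp hY
    have hfull : ∀ i, chatterjeeXi P (fun ω => Y ω i) (joinVec X (precedingResponses Y i))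
        = gaussianXi (multipleCorr S (idxFull i) (Sum.inr i) (G i)) := fun i => by
      rw [← chatterjeeXi_of_isMultivariateNormal hXY h (idxFull i) (Sum.inr i) (hpos i) (hG i)]
      congr 1
      ext ω a
      rcases a with a | a <;> rfl
    have hprec : ∀ i, xiPreceding P Y i
        = gaussianXi (multipleCorr S (idxPreceding i) (Sum.inr i) (H i)) := fun i => by
      rw [xiPreceding]
      split_ifs with hi
      -- The first response has no predecessors: the empty sum gives correlation 0, and
      -- `gaussianXi_zero` agrees with the convention ξ(Y₁|∅) = 0.
      · have : IsEmpty {j : Fin q // j < i} :=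
          ⟨fun j => absurd (Fin.lt_def.1 j.2) (by omega)⟩
        have h0 : multipleCorr S (idxPreceding i) (Sum.inr i) (H i) = 0 := by
          simp [multipleCorr, dotProduct]
        rw [h0, gaussianXi_zero]
      · exact chatterjeeXi_of_isMultivariateNormal hXY h (idxPreceding i) (Sum.inr i) (hpos i)
          (hH i)
    simp only [predictabilityT, hfull, hprec]
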